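/- Let $a,b\in\mathbb C$ with $|a|^2+|b|^2=1$ and $a\neq 0$ (equivalently $|b|<1$), let $\alpha,\beta\in\mathbb C$ with $|\alpha|^2+|\beta|^2=1$, and let $m,n$ be integers with $0<m<n$. Write $C_1=\{-1,1\}$, and $R,L$ for the internal states $+1,-1\in C_1$. Let $Q_{a,b}=T(I\otimes U)$ be the quantum walk operator on $\ell^2(\mathbb Z\times C_1)$, where $U=\begin{bmatrix} a & b\\ -\bar b & \bar a\end{bmatrix}$ acts on internal states in the ordered basis $(|R\rangle,|L\rangle)$ and $T|x\rangle|\sigma\rangle=|x+\sigma\rangle|\sigma\rangle$. Let $\Pi$ be the orthogonal projection of $\ell^2(\mathbb Z\times C_1)$ onto the closed span of the $|x\rangle|\sigma\rangle$ with $x\notin\{0,n\}$, and put $\psi=|m\rangle(\alpha|R\rangle+\beta|L\rangle)$. For $B_0\subseteq\{0,n\}\times C_1$, the probability that the walk with absorbing boundaries at $0$ and $n$ and initial state $\psi$ is eventually absorbed in $B_0$, before being absorbed at any other boundary state, is $$\sum_{t=1}^\infty\ \sum_{(x,\sigma)\in B_0}\bigl|\langle x,\sigma|\,Q_{a,b}(\Pi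 Q_{a,b})^{t-1}\,|\psi\rangle\bigr|^2 .$$ Let $P_n^{(m)}(\alpha,\beta;a,b)$ be this probability for $B_0=\{(0,L)\}$ (left absorption). Then $$P_n^{(m)}(\alpha,\beta;a,b)+P_n^{(n-m)}(\beta,\alpha;\bar a,-\bar b)=1 .$$ Moreover, $P_n^{(n-m)}(\beta,\alpha;\bar a,-\bar b)$ equals the probability for $B_0=\{(n,R)\}$ (right absorption) of the original walk, that is, the walk with parameters $a,b$ and initial state $\psi$; and the probability for $B_0=\{0,n\}\times C_1$ is $1$, so the particle is almost surely absorbed at one of the two boundaries. -/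

import Mathlib

open scoped ENNReal ComplexConjugate

noncomputable section

/-- The Hilbert space `ℓ²(ι)` of square-summable complex amplitudes on `ι`. -/
abbrev EllTwo (ι : Type*) : Type _ := lp (fun _ : ι => ℂ) 2

/-- The orthonormal basis vector `|x⟩` of `ℓ²(ι)`. -/
def ket {ι : Type*} [DecidableEq ι] (x : ι) : EllTwo ι :=
  lp.single 2 x (1 : ℂ)

section Walk

variable {G : Type*} [AddGroup G] {S : Finset G}

/-- The coin operator `I ⊗ U` on `ℓ²(G × S)`: it sends `|g⟩|τ⟩` to `∑ σ, U σ τ |g⟩|σ⟩`. -/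
def coinOperator (U : Matrix S S ℂ) : EllTwo (G × S) →ₗ[ℂ] EllTwo (G × S) where
  toFun ψ := ⟨fun x => ∑ τ : S, U x.2 τ * ψ (x.1, τ), by
    have hsum : ∀ τ : S, Summable fun x : G × S => ‖ψ (x.1, τ)‖ ^ (2 : ℝ) := by
      intro τ
      have h := (lp.memℓp ψ).summable (by norm_num)
      have h1 : Summable fun g : G => ‖ψ (g, τ)‖ ^ (2 : ℝ) := by
        simpa [Function.comp_def] using
          h.comp_injective (i := fun g : G => (g, τ)) (fun x y hxy => by simpa using hxy)
      have h2 : Summable fun x : S × G => ‖ψ (x.2, τ)‖ ^ (2 : ℝ) := by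
        rw [summable_prod_of_nonneg (fun x => by positivity)]
        exact ⟨fun _ => h1, (hasSum_fintype _).summable⟩
      exact (Equiv.prodComm G S).summable_iff.mpr h2
    have hmem : ∀ τ : S, Memℓp (fun x : G × S => U x.2 τ * ψ (x.1, τ)) 2 := by
      intro τ
      refine memℓp_gen (((hsum τ).mul_left (∑ σ : S, ‖U σ τ‖ ^ (2 : ℝ))).of_nonneg_of_le
        (fun x => by positivity) (fun x => ?_))
      have hle : ‖U x.2 τ‖ ^ (2 : ℝ) ≤ ∑ σ : S, ‖U σ τ‖ ^ (2 : ℝ) :=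
        Finset.single_le_sum (f := fun σ : S => ‖U σ τ‖ ^ (2 : ℝ))
          (fun σ _ => by positivity) (Finset.mem_univ x.2)
      simp only [ENNReal.toReal_ofNat, norm_mul]
      rw [Real.mul_rpow (norm_nonneg _) (norm_nonneg _)]
      exact mul_le_mul_of_nonneg_right hle (by positivity)
    exact Memℓp.finsetSum Finset.univ (fun τ _ => hmem τ)⟩
  map_add' ψ φ := by
    refine Subtype.ext (funext fun x => ?_)
    simp [mul_add, Finset.sum_add_distrib]
    rfl
  map_smul' c ψ := by
    ext x
    simp [Finset.mul_sum, mul_left_comm]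

/-- The translation operator `T : |g⟩|σ⟩ ↦ |σ + g⟩|σ⟩` on `ℓ²(G × S)`; thus
`(T ψ)(g, σ) = ψ(-σ + g, σ)`. -/
def translationOperator : EllTwo (G × S) →ₗ[ℂ] EllTwo (G × S) where
  toFun ψ := ⟨fun x => ψ (-(x.2 : G) + x.1, x.2), by
    have h := (lp.memℓp ψ).summable (by norm_num)
    refine memℓp_gen (h.comp_injective (i := fun x : G × S => (-(x.2 : G) + x.1, x.2)) ?_)
    rintro ⟨g, σ⟩ ⟨g', σ'⟩ hxy
    simp only [Prod.mk.injEq] at hxy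
    obtain ⟨h1, rfl⟩ := hxy
    simpa using h1⟩
  map_add' _ _ := rfl
  map_smul' _ _ := rfl

/-- The quantum walk operator `Q = T (I ⊗ U)` of the triple `(G, S, U)`, for a unitary
matrix `U`. (Unitarity is not needed to write the operator down.) -/
def quantumWalkOperator (U : Matrix S S ℂ) : Module.End ℂ (EllTwo (G × S)) :=
  translationOperator ∘ₗ coinOperator U

/-- The measurement projection `Π_no^B`, onto the closed span of the `|x⟩` with `x ∉ B`. -/
def projectionNo (B : Set (G × S)) : Module.End ℂ (EllTwo (G × S)) where
  toFun ψ := ⟨Bᶜ.indicator ψ, by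
    have h := (lp.memℓp ψ).summable (by norm_num)
    refine memℓp_gen (h.of_nonneg_of_le (fun x => by positivity) (fun x => ?_))
    exact Real.rpow_le_rpow (norm_nonneg _) (norm_indicator_le_norm_self _ _) (by norm_num)⟩
  map_add' _ _ := by
    exact Subtype.ext (Set.indicator_add' _ _ _)
  map_smul' c _ := by
    exact Subtype.ext (Set.indicator_const_smul _ c _)

/-- The absorbing quantum walk operator `Π_no^B Q` of the quadruple `(G, S, U, B)`. -/
def absorbingWalkOperator (U : Matrix S S ℂ) (B : Set (G × S)) :
    Module.End ℂ (EllTwo (G × S)) :=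
  projectionNo B ∘ₗ quantumWalkOperator U

/-- The probability that the `(G, S, U, B)` absorbing quantum walk with initial state `ψ` is
eventually absorbed in `B₀ ⊆ B` before it is absorbed in `B \ B₀`:
`∑_{t ≥ 1} ∑_{b ∈ B₀} |⟨b| Q (Π_no^B Q)^(t-1) |ψ⟩|²`. The index `t` below is the `t - 1` of
this formula. The sum is taken in `[0, ∞]`, so that it always has its proper value. -/
def absorptionProbability [DecidableEq G] (U : Matrix S S ℂ) (B B₀ : Set (G × S))
    (ψ : EllTwo (G × S)) : ℝ≥0∞ :=
  ∑' t : ℕ, ∑' b : B₀, ENNReal.ofReal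
    (‖inner ℂ (ket (b : G × S)) (quantumWalkOperator U ((absorbingWalkOperator U B ^ t) ψ))‖ ^ 2)

end Walk

/-- The set of directions `C₁ = {-1, 1}` in `ℤ`. -/
def C₁ : Finset ℤ := {-1, 1}

/-- The internal state `R`, which moves one step to the right. -/
def dirR : C₁ := ⟨1, by simp [C₁]⟩

/-- The internal state `L`, which moves one step to the left. -/
def dirL : C₁ := ⟨-1, by simp [C₁]⟩

/-- The matrix with rows `(a, b)` and `(-b̄, ā)`, both rows and columns being
indexed in the order `R`, `L`. -/
def twoStateCoin (a b : ℂ) : Matrix C₁ C₁ ℂ := fun σ τ =>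
  if σ = dirR then (if τ = dirR then a else b)
  else (if τ = dirR then -conj b else conj a)

/-- The absorbing set of the walk with boundaries at positions `0` and `n`. -/
def boundarySet (n : ℤ) : Set (ℤ × C₁) := {x | x.1 = 0 ∨ x.1 = n}

/-- The initial state `|m⟩(α|R⟩ + β|L⟩)`. -/
def initialState (m : ℤ) (α β : ℂ) : EllTwo (ℤ × C₁) :=
  α • ket (m, dirR) + β • ket (m, dirL)

/-- `P_n^{(m)}(α, β; a, b)`: the probability that the `(ℤ, C₁, U, {0, n})` absorbing walk started
in `|m⟩(α|R⟩ + β|L⟩)` is eventually absorbed at `|0⟩|L⟩`, before being absorbed at `|n⟩|R⟩`. -/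
def leftAbsorption (n m : ℤ) (α β a b : ℂ) : ℝ≥0∞ :=
  absorptionProbability (twoStateCoin a b) (boundarySet n) {((0 : ℤ), dirL)} (initialState m α β)

/-- The probability that the same walk is eventually absorbed at `|n⟩|R⟩`, before being absorbed
at `|0⟩|L⟩`. -/
def rightAbsorption (n m : ℤ) (α β a b : ℂ) : ℝ≥0∞ :=
  absorptionProbability (twoStateCoin a b) (boundarySet n) {(n, dirR)} (initialState m α β)

/-- The probability that the same walk is eventually absorbed at all, at `0` or at `n`. -/
def totalAbsorption (n m : ℤ) (α β a b : ℂ) : ℝ≥0∞ :=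
  absorptionProbability (twoStateCoin a b) (boundarySet n) (boundarySet n) (initialState m α β)

end

/-! The coin is unitary, so the norm inside the interval decreases at each step by exactly what
leaves through the two ends (`energy_eq`). The losses are therefore summable, and the amplitude
emitted at the left end tends to zero. Since `a ≠ 0`, the recursion can be solved for the next site
to the right, so this decay spreads to every interior site (`tendsto_amplitude`). The interval is
finite, so the remaining norm tends to zero and the losses add up to the initial norm, which is 1.
Reflection in the midpoint turns right absorption into left absorption of the walk with coin `(conj
a, -conj b)` (`walkAmplitude_reflect`). -/

/-- The amplitudes `r t x` and `l t x` at `|x⟩|R⟩` and `|x⟩|L⟩`, at time `t`, of a two-state walk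
with coin parameters `a`, `b` and absorbing boundaries at `0` and `n`, the initial amplitudes
being supported strictly between the boundaries. -/
structure IsTwoStateWalk (n : ℤ) (a b : ℂ) (r l : ℕ → ℤ → ℂ) : Prop where
  right_zero : ∀ x, x ≤ 0 ∨ n ≤ x → r 0 x = 0
  left_zero : ∀ x, x ≤ 0 ∨ n ≤ x → l 0 x = 0
  right_succ : ∀ t x, r (t + 1) x =
    if x = 0 ∨ x = n then 0 else a * r t (x - 1) + b * l t (x - 1)
  left_succ : ∀ t x, l (t + 1) x =
    if x = 0 ∨ x = n then 0 else -conj b * r t (x + 1) + conj a * l t (x + 1)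

theorem sum_Ioo_shift (n : ℤ) (hn : 1 ≤ n) (G : ℤ → ℝ) :
    ∑ x ∈ Finset.Ioo 0 n, G (x + 1) + G 1 = ∑ x ∈ Finset.Ioo 0 n, G x + G n := by
  induction n, hn using Int.leInduction with
  | base =>
    have h : Finset.Ioo (0 : ℤ) 1 = ∅ := by ext x; simp; omega
    simp [h]
  | succ k hk ih =>
    have h : Finset.Ioo (0 : ℤ) (k + 1) = insert k (Finset.Ioo 0 k) := by
      ext x; simp; omega
    rw [h, Finset.sum_insert (by simp), Finset.sum_insert (by simp)]
    linarith

theorem twoStateCoin_norm_sq (a b r l : ℂ) (hU : ‖a‖ ^ 2 + ‖b‖ ^ 2 = 1) :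
    ‖a * r + b * l‖ ^ 2 + ‖-conj b * r + conj a * l‖ ^ 2 = ‖r‖ ^ 2 + ‖l‖ ^ 2 := by
  rw [← one_mul (‖r‖ ^ 2 + ‖l‖ ^ 2), ← hU]
  simp only [← Complex.normSq_eq_norm_sq, Complex.normSq_apply, Complex.add_re, Complex.add_im,
    Complex.mul_re, Complex.mul_im, Complex.neg_re, Complex.neg_im, Complex.conj_re,
    Complex.conj_im]
  ring

namespace IsTwoStateWalk

open Filter Topology

variable {n : ℤ} {a b : ℂ} {r l : ℕ → ℤ → ℂ}

theorem support (h : IsTwoStateWalk n a b r l) (t : ℕ) (x : ℤ) (hx : x ≤ 0 ∨ n ≤ x) :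
    r t x = 0 ∧ l t x = 0 := by
  induction t generalizing x with
  | zero => exact ⟨h.right_zero x hx, h.left_zero x hx⟩
  | succ t ih =>
    rw [h.right_succ, h.left_succ]
    by_cases hb : x = 0 ∨ x = n
    · simp [hb]
    · have h1 := ih (x - 1)
      have h2 := ih (x + 1)
      rcases hx with hx | hx
      · simp [h1 (by omega), h2 (by omega)]
      · by_cases hn : n ≤ x - 1
        · simp [h1 (by omega), h2 (by omega)]
        · omega

/-- The probability of not being absorbed up to time `t`. -/
noncomputable def energy (n : ℤ) (r l : ℕ → ℤ → ℂ) (t : ℕ) : ℝ :=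
  ∑ x ∈ Finset.Ioo 0 n, (‖r t x‖ ^ 2 + ‖l t x‖ ^ 2)

/-- The probability of being absorbed at step `t + 1`. -/
noncomputable def loss (n : ℤ) (a b : ℂ) (r l : ℕ → ℤ → ℂ) (t : ℕ) : ℝ :=
  ‖-conj b * r t 1 + conj a * l t 1‖ ^ 2 + ‖a * r t (n - 1) + b * l t (n - 1)‖ ^ 2

theorem energy_nonneg (t : ℕ) : 0 ≤ energy n r l t :=
  Finset.sum_nonneg fun _ _ => by positivity

theorem loss_nonneg (t : ℕ) : 0 ≤ loss n a b r l t := by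
  unfold loss; positivity

/-- Summing the coin's norm identity over the interior, then shifting the R part right and the L
part left, leaves one boundary term at each end. -/
theorem energy_eq (h : IsTwoStateWalk n a b r l) (hn : 1 ≤ n) (hU : ‖a‖ ^ 2 + ‖b‖ ^ 2 = 1)
    (t : ℕ) : energy n r l t = energy n r l (t + 1) + loss n a b r l t := by
  have hR := sum_Ioo_shift n hn fun x => ‖a * r t (x - 1) + b * l t (x - 1)‖ ^ 2
  have hL := sum_Ioo_shift n hn fun x => ‖-conj b * r t x + conj a * l t x‖ ^ 2
  -- The opposite end terms vanish: nothing enters the interval from 0 or from `n`.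
  simp only [add_sub_cancel_right, sub_self, (h.support t 0 (Or.inl le_rfl)).1,
    (h.support t 0 (Or.inl le_rfl)).2] at hR
  simp only [(h.support t n (Or.inr le_rfl)).1, (h.support t n (Or.inr le_rfl)).2] at hL
  have hE : energy n r l t = ∑ x ∈ Finset.Ioo 0 n, ‖a * r t x + b * l t x‖ ^ 2 +
      ∑ x ∈ Finset.Ioo 0 n, ‖-conj b * r t x + conj a * l t x‖ ^ 2 := by
    rw [← Finset.sum_add_distrib]
    exact Finset.sum_congr rfl fun x _ => (twoStateCoin_norm_sq a b _ _ hU).symm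
  have hE' : energy n r l (t + 1) =
      ∑ x ∈ Finset.Ioo 0 n, ‖a * r t (x - 1) + b * l t (x - 1)‖ ^ 2 +
      ∑ x ∈ Finset.Ioo 0 n, ‖-conj b * r t (x + 1) + conj a * l t (x + 1)‖ ^ 2 := by
    rw [← Finset.sum_add_distrib]
    refine Finset.sum_congr rfl fun x hx => ?_
    rw [Finset.mem_Ioo] at hx
    rw [h.right_succ, h.left_succ, if_neg (by omega), if_neg (by omega)]
  simp only [mul_zero, add_zero, norm_zero, ne_eq, OfNat.ofNat_ne_zero, not_false_eq_true,
    zero_pow] at hR hL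
  rw [hE, hE', loss]
  linarith

theorem sum_loss (h : IsTwoStateWalk n a b r l) (hn : 1 ≤ n) (hU : ‖a‖ ^ 2 + ‖b‖ ^ 2 = 1)
    (T : ℕ) : ∑ t ∈ Finset.range T, loss n a b r l t = energy n r l 0 - energy n r l T := by
  rw [← Finset.sum_range_sub' (energy n r l)]
  exact Finset.sum_congr rfl fun t _ => by rw [h.energy_eq hn hU t]; ring

theorem summable_loss (h : IsTwoStateWalk n a b r l) (hn : 1 ≤ n) (hU : ‖a‖ ^ 2 + ‖b‖ ^ 2 = 1) :
    Summable (loss n a b r l) :=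
  summable_of_sum_range_le (c := energy n r l 0) (fun t => loss_nonneg t) fun T => by
    rw [h.sum_loss hn hU]
    linarith [energy_nonneg (n := n) (r := r) (l := l) T]

theorem tendsto_left_boundary (h : IsTwoStateWalk n a b r l) (hn : 1 ≤ n)
    (hU : ‖a‖ ^ 2 + ‖b‖ ^ 2 = 1) :
    Tendsto (fun t => -conj b * r t 1 + conj a * l t 1) atTop (𝓝 0) := by
  have h1 : Tendsto (fun t => ‖-conj b * r t 1 + conj a * l t 1‖ ^ 2) atTop (𝓝 0) :=
    squeeze_zero (fun t => by positivity)
      (fun t => by rw [loss]; exact le_add_of_nonneg_right (by positivity))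
      (h.summable_loss hn hU).tendsto_atTop_zero
  rw [tendsto_zero_iff_norm_tendsto_zero]
  simpa using h1.sqrt

/-- Induction from the left end. Decay at `x` gives decay of `r` at `x + 1` directly; the recursion
for `l` at `x`, read backwards, then gives `l` at `x + 1`, on dividing by `conj a`. -/
theorem tendsto_amplitude (h : IsTwoStateWalk n a b r l) (hn : 1 ≤ n)
    (hU : ‖a‖ ^ 2 + ‖b‖ ^ 2 = 1) (ha : a ≠ 0) (x : ℕ) (hx : (x : ℤ) < n) :
    Tendsto (fun t => r t x) atTop (𝓝 0) ∧ Tendsto (fun t => l t x) atTop (𝓝 0) := by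
  induction x with
  | zero =>
    have hs := fun t => h.support t 0 (Or.inl le_rfl)
    simp [hs]
  | succ x ih =>
    obtain ⟨hr, hl⟩ := ih (by push_cast at hx; omega)
    push_cast at hx ⊢
    have hr' : Tendsto (fun t => r t (x + 1)) atTop (𝓝 0) := by
      rw [← tendsto_add_atTop_iff_nat 1]
      have h1 := (hr.const_mul a).add (hl.const_mul b)
      rw [mul_zero, mul_zero, add_zero] at h1
      refine h1.congr fun t => ?_
      rw [h.right_succ, if_neg (by omega), add_sub_cancel_right]
    refine ⟨hr', ?_⟩
    have hd : Tendsto (fun t => -conj b * r t (x + 1) + conj a * l t (x + 1)) atTop (𝓝 0) := by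
      -- At site 0 the amplitude `l` is erased by absorption and carries no information; summability
      -- of the loss replaces it.
      rcases Nat.eq_zero_or_pos x with rfl | hpos
      · simpa using h.tendsto_left_boundary hn hU
      · refine ((tendsto_add_atTop_iff_nat 1).2 hl).congr fun t => ?_
        rw [h.left_succ, if_neg (by omega)]
    have ha' : conj a ≠ 0 := by simpa using ha
    have h2 := (hd.sub (hr'.const_mul (-conj b))).const_mul (conj a)⁻¹
    simp only [mul_zero, sub_zero] at h2
    refine h2.congr fun t => ?_
    rw [add_sub_cancel_left, inv_mul_cancel_left₀ ha']

theorem tendsto_energy (h : IsTwoStateWalk n a b r l) (hn : 1 ≤ n)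
    (hU : ‖a‖ ^ 2 + ‖b‖ ^ 2 = 1) (ha : a ≠ 0) :
    Tendsto (energy n r l) atTop (𝓝 0) := by
  rw [← Finset.sum_const_zero (s := Finset.Ioo 0 n)]
  refine tendsto_finsetSum _ fun x hx => ?_
  rw [Finset.mem_Ioo] at hx
  lift x to ℕ using hx.1.le
  obtain ⟨h1, h2⟩ := h.tendsto_amplitude hn hU ha x hx.2
  simpa using (h1.norm.pow 2).add (h2.norm.pow 2)

theorem hasSum_loss (h : IsTwoStateWalk n a b r l) (hn : 1 ≤ n) (hU : ‖a‖ ^ 2 + ‖b‖ ^ 2 = 1)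
    (ha : a ≠ 0) : HasSum (loss n a b r l) (energy n r l 0) := by
  rw [hasSum_iff_tendsto_nat_of_nonneg fun t => loss_nonneg t]
  simp only [h.sum_loss hn hU]
  simpa using (h.tendsto_energy hn hU ha).const_sub (energy n r l 0)

end IsTwoStateWalk

/-! ### From operators on `ℓ²` to amplitudes. -/

theorem dirL_ne_dirR : dirL ≠ dirR := by
  intro h
  exact absurd (congrArg Subtype.val h) (by norm_num [dirL, dirR])

theorem eq_dirR_or_dirL (σ : C₁) : σ = dirR ∨ σ = dirL := by
  obtain ⟨s, hs⟩ := σ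
  simp only [C₁, Finset.mem_insert, Finset.mem_singleton] at hs
  rcases hs with rfl | rfl
  · exact Or.inr rfl
  · exact Or.inl rfl

theorem sum_directions (f : C₁ → ℂ) : ∑ σ : C₁, f σ = f dirR + f dirL := by
  have h : (Finset.univ : Finset C₁) = {dirR, dirL} := by
    ext σ; simpa using eq_dirR_or_dirL σ
  rw [h, Finset.sum_pair dirL_ne_dirR.symm]

theorem ket_apply {ι : Type*} [DecidableEq ι] (x y : ι) :
    (ket x : EllTwo ι) y = if y = x then 1 else 0 := by
  rw [ket, lp.single_apply]
  split_ifs with h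
  · subst h; simp
  · simp [h]

theorem inner_ket {ι : Type*} [DecidableEq ι] (x : ι) (φ : EllTwo ι) :
    inner ℂ (ket x) φ = φ x := by
  rw [ket, lp.inner_single_left]
  simp

theorem quantumWalk_apply_dirR (a b : ℂ) (φ : EllTwo (ℤ × C₁)) (x : ℤ) :
    quantumWalkOperator (twoStateCoin a b) φ (x, dirR) =
      a * φ (x - 1, dirR) + b * φ (x - 1, dirL) := by
  change ∑ τ : C₁, twoStateCoin a b dirR τ * φ (-1 + x, τ) = _
  rw [sum_directions, neg_add_eq_sub]
  simp [twoStateCoin, dirL_ne_dirR]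

theorem quantumWalk_apply_dirL (a b : ℂ) (φ : EllTwo (ℤ × C₁)) (x : ℤ) :
    quantumWalkOperator (twoStateCoin a b) φ (x, dirL) =
      -conj b * φ (x + 1, dirR) + conj a * φ (x + 1, dirL) := by
  change ∑ τ : C₁, twoStateCoin a b dirL τ * φ (-(-1) + x, τ) = _
  rw [sum_directions, neg_neg, add_comm 1 x]
  simp [twoStateCoin, dirL_ne_dirR]

open Classical in
theorem projectionNo_apply {G : Type*} [AddGroup G] {S : Finset G} (B : Set (G × S))
    (φ : EllTwo (G × S)) (x : G × S) : projectionNo B φ x = if x ∈ B then 0 else φ x := by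
  change Bᶜ.indicator φ x = _
  by_cases h : x ∈ B <;> simp [h]

/-- The amplitude at `|x⟩|σ⟩`, at time `t`, of the walk with boundaries at `0` and `n`. -/
noncomputable def walkAmplitude (n m : ℤ) (α β a b : ℂ) (σ : C₁) (t : ℕ) (x : ℤ) : ℂ :=
  ((absorbingWalkOperator (twoStateCoin a b) (boundarySet n) ^ t) (initialState m α β)) (x, σ)

theorem initialState_apply (m : ℤ) (α β : ℂ) (x : ℤ) (σ : C₁) :
    initialState m α β (x, σ) = if x = m then (if σ = dirR then α else β) else 0 := by
  change α * ket (m, dirR) (x, σ) + β * ket (m, dirL) (x, σ) = _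
  rw [ket_apply, ket_apply]
  rcases eq_dirR_or_dirL σ with rfl | rfl
  · simp [dirL_ne_dirR.symm]
  · simp [dirL_ne_dirR]

theorem isTwoStateWalk_walkAmplitude (n m : ℤ) (hm : 0 < m) (hmn : m < n) (α β a b : ℂ) :
    IsTwoStateWalk n a b (walkAmplitude n m α β a b dirR) (walkAmplitude n m α β a b dirL) where
  right_zero x hx := by
    change initialState m α β (x, dirR) = 0
    rw [initialState_apply, if_neg (by omega)]
  left_zero x hx := by
    change initialState m α β (x, dirL) = 0
    rw [initialState_apply, if_neg (by omega)]
  right_succ t x := by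
    rw [walkAmplitude, pow_succ']
    change projectionNo _ (quantumWalkOperator _ _) _ = _
    rw [projectionNo_apply, quantumWalk_apply_dirR]
    classical exact if_congr Iff.rfl rfl rfl
  left_succ t x := by
    rw [walkAmplitude, pow_succ']
    change projectionNo _ (quantumWalkOperator _ _) _ = _
    rw [projectionNo_apply, quantumWalk_apply_dirL]
    classical exact if_congr Iff.rfl rfl rfl

theorem energy_walkAmplitude_zero (n m : ℤ) (hm : 0 < m) (hmn : m < n) (α β a b : ℂ) :
    IsTwoStateWalk.energy n (walkAmplitude n m α β a b dirR) (walkAmplitude n m α β a b dirL) 0 =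
      ‖α‖ ^ 2 + ‖β‖ ^ 2 := by
  have h : ∀ σ x, walkAmplitude n m α β a b σ 0 x =
      if x = m then (if σ = dirR then α else β) else 0 :=
    fun σ x => initialState_apply m α β x σ
  rw [IsTwoStateWalk.energy, Finset.sum_eq_single m]
  · simp [h, dirL_ne_dirR]
  · intro x _ hx
    simp [h, hx]
  · intro hx
    exact absurd (Finset.mem_Ioo.2 ⟨hm, hmn⟩) hx

theorem leftAbsorption_eq_tsum (n m : ℤ) (α β a b : ℂ) :
    leftAbsorption n m α β a b = ∑' t : ℕ, ENNReal.ofReal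
      (‖-conj b * walkAmplitude n m α β a b dirR t 1 +
        conj a * walkAmplitude n m α β a b dirL t 1‖ ^ 2) := by
  rw [leftAbsorption, absorptionProbability]
  refine tsum_congr fun t => ?_
  rw [tsum_singleton ((0 : ℤ), dirL) fun y => ENNReal.ofReal (‖inner ℂ (ket y)
    (quantumWalkOperator (twoStateCoin a b) ((absorbingWalkOperator (twoStateCoin a b)
      (boundarySet n) ^ t) (initialState m α β)))‖ ^ 2), inner_ket, quantumWalk_apply_dirL]
  rfl

theorem rightAbsorption_eq_tsum (n m : ℤ) (α β a b : ℂ) :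
    rightAbsorption n m α β a b = ∑' t : ℕ, ENNReal.ofReal
      (‖a * walkAmplitude n m α β a b dirR t (n - 1) +
        b * walkAmplitude n m α β a b dirL t (n - 1)‖ ^ 2) := by
  rw [rightAbsorption, absorptionProbability]
  refine tsum_congr fun t => ?_
  rw [tsum_singleton (n, dirR) fun y => ENNReal.ofReal (‖inner ℂ (ket y)
    (quantumWalkOperator (twoStateCoin a b) ((absorbingWalkOperator (twoStateCoin a b)
      (boundarySet n) ^ t) (initialState m α β)))‖ ^ 2), inner_ket, quantumWalk_apply_dirR]
  rfl

/-- The boundary states `(0, R)` and `(n, L)` could only be reached from `-1` and `n + 1`, where the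
amplitude is always zero. -/
theorem totalAbsorption_eq_add (n m : ℤ) (hm : 0 < m) (hmn : m < n) (α β a b : ℂ) :
    totalAbsorption n m α β a b = leftAbsorption n m α β a b + rightAbsorption n m α β a b := by
  have hw := isTwoStateWalk_walkAmplitude n m hm hmn α β a b
  rw [leftAbsorption_eq_tsum, rightAbsorption_eq_tsum, ← ENNReal.tsum_add, totalAbsorption,
    absorptionProbability]
  refine tsum_congr fun t => ?_
  rw [tsum_subtype (boundarySet n) fun y => ENNReal.ofReal (‖inner ℂ (ket y)
    (quantumWalkOperator (twoStateCoin a b) ((absorbingWalkOperator (twoStateCoin a b)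
      (boundarySet n) ^ t) (initialState m α β)))‖ ^ 2),
    tsum_eq_sum (s := {((0 : ℤ), dirL), (n, dirR)})]
  · rw [Finset.sum_pair (by simp [dirL_ne_dirR]),
      Set.indicator_of_mem (show ((0 : ℤ), dirL) ∈ boundarySet n from Or.inl rfl),
      Set.indicator_of_mem (show (n, dirR) ∈ boundarySet n from Or.inr rfl),
      inner_ket, inner_ket, quantumWalk_apply_dirL, quantumWalk_apply_dirR]
    rfl
  · rintro ⟨x, σ⟩ hx
    by_cases hB : (x, σ) ∈ boundarySet n
    · rw [Set.indicator_of_mem hB, inner_ket]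
      have hB' : x = 0 ∨ x = n := hB
      have hs := fun y => hw.support t y
      simp only [walkAmplitude] at hs
      rcases eq_dirR_or_dirL σ with rfl | rfl
      · rw [quantumWalk_apply_dirR]
        have hx0 : x = 0 := hB'.resolve_right fun h => by simp [h] at hx
        obtain ⟨h1, h2⟩ := hs (x - 1) (by omega)
        simp [h1, h2]
      · rw [quantumWalk_apply_dirL]
        have hxn : x = n := hB'.resolve_left fun h => by simp [h] at hx
        obtain ⟨h1, h2⟩ := hs (x + 1) (by omega)
        simp [h1, h2]
    · exact Set.indicator_of_notMem hB _

/-- Almost surely the walk is absorbed at one of the two boundaries. -/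
theorem leftAbsorption_add_rightAbsorption (n m : ℤ) (hm : 0 < m) (hmn : m < n) (a b α β : ℂ)
    (hU : ‖a‖ ^ 2 + ‖b‖ ^ 2 = 1) (ha : a ≠ 0) (hψ : ‖α‖ ^ 2 + ‖β‖ ^ 2 = 1) :
    leftAbsorption n m α β a b + rightAbsorption n m α β a b = 1 := by
  have hs := (isTwoStateWalk_walkAmplitude n m hm hmn α β a b).hasSum_loss (by omega) hU ha
  rw [energy_walkAmplitude_zero n m hm hmn, hψ] at hs
  rw [leftAbsorption_eq_tsum, rightAbsorption_eq_tsum, ← ENNReal.tsum_add,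
    ← ENNReal.ofReal_one, ← hs.tsum_eq,
    ENNReal.ofReal_tsum_of_nonneg (fun t => IsTwoStateWalk.loss_nonneg t) hs.summable]
  refine tsum_congr fun t => ?_
  rw [← ENNReal.ofReal_add (by positivity) (by positivity)]
  rfl

/-! ### Reflection symmetry and conclusion. -/

/-- Reflecting the walk in the midpoint of the two boundaries exchanges the internal states. -/
theorem walkAmplitude_reflect (n m : ℤ) (hm : 0 < m) (hmn : m < n) (α β a b : ℂ) (t : ℕ) (x : ℤ) :
    walkAmplitude n (n - m) β α (conj a) (-conj b) dirR t x =
        walkAmplitude n m α β a b dirL t (n - x) ∧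
      walkAmplitude n (n - m) β α (conj a) (-conj b) dirL t x =
        walkAmplitude n m α β a b dirR t (n - x) := by
  have hw := isTwoStateWalk_walkAmplitude n m hm hmn α β a b
  have hw' := isTwoStateWalk_walkAmplitude n (n - m) (by omega) (by omega) β α (conj a) (-conj b)
  induction t generalizing x with
  | zero =>
    change initialState (n - m) β α (x, dirR) = initialState m α β (n - x, dirL) ∧
      initialState (n - m) β α (x, dirL) = initialState m α β (n - x, dirR)
    have hx : x = n - m ↔ n - x = m := by omega
    simp [initialState_apply, hx, dirL_ne_dirR]
  | succ t ih =>
    have hx : (x = 0 ∨ x = n) ↔ (n - x = 0 ∨ n - x = n) := by omega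
    have h1 := ih (x - 1)
    have h2 := ih (x + 1)
    rw [show n - (x - 1) = n - x + 1 by ring] at h1
    rw [show n - (x + 1) = n - x - 1 by ring] at h2
    rw [hw'.right_succ, hw'.left_succ, hw.right_succ, hw.left_succ, h1.1, h1.2, h2.1, h2.2]
    -- Exchanging R and L turns the coin into the matrix with rows `(conj a, -conj b)` and `(b, a)`,
    -- which is `twoStateCoin (conj a) (-conj b)`.
    simp only [hx, map_neg, Complex.conj_conj, neg_neg]
    exact ⟨by rw [add_comm (conj a * _)], by rw [add_comm (b * _)]⟩

theorem leftAbsorption_reflect (n m : ℤ) (hm : 0 < m) (hmn : m < n) (α β a b : ℂ) :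
    leftAbsorption n (n - m) β α (conj a) (-conj b) = rightAbsorption n m α β a b := by
  rw [leftAbsorption_eq_tsum, rightAbsorption_eq_tsum]
  refine tsum_congr fun t => ?_
  obtain ⟨h1, h2⟩ := walkAmplitude_reflect n m hm hmn α β a b t 1
  rw [h1, h2, map_neg, Complex.conj_conj, Complex.conj_conj, neg_neg, add_comm (b * _)]

theorem theorem4p5 (m n : ℤ) (hm : 0 < m) (hmn : m < n) (a b α β : ℂ)
    (hU : ‖a‖ ^ 2 + ‖b‖ ^ 2 = 1) (ha : a ≠ 0) (hψ : ‖α‖ ^ 2 + ‖β‖ ^ 2 = 1) :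
    leftAbsorption n m α β a b + leftAbsorption n (n - m) β α (conj a) (-conj b) = 1 ∧
    leftAbsorption n (n - m) β α (conj a) (-conj b) = rightAbsorption n m α β a b ∧
    totalAbsorption n m α β a b = 1 := by
  rw [leftAbsorption_reflect n m hm hmn, totalAbsorption_eq_add n m hm hmn]
  have h := leftAbsorption_add_rightAbsorption n m hm hmn a b α β hU ha hψ
  exact ⟨h, rfl, h⟩
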